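/- For a complex Hilbert space $E$ (for instance $\mathbb{C}^d$ or $\ell^2$) with open unit ball $\mathbb{B}_E$, let $\mathcal{H}_E$ be Drury--Arveson space, the Hilbert space of functions on $\mathbb{B}_E$ with reproducing kernel $k(x,y)=k_y(x)=\frac{1}{1-\langle x,y\rangle}$, and let $\mathcal{M}_E$ be its multiplier algebra, that is, the algebra of all functions $f$ on $\mathbb{B}_E$ with $f\mathcal{H}_E\subseteq\mathcal{H}_E$. A variety in $\mathbb{B}_E$ is the common zero set in $\mathbb{B}_E$ of a family of functions in $\mathcal{M}_E$. For a variety $V$ let $\mathcal{H}_V=\overline{\operatorname{span}}\{k_y:y\in V\}$, considered as a space of functions on $V$, and let $\mathcal{M}_V$ be its multiplier algebra, an algebra of functions on $V$. A map from a subset of a Hilbert space into a Hilbert space is holomorphic if near each point of its domain it is the restriction of a holomorphic (Fréchet differentiable) map defined on a ball around that point in the ambient Hilbert space; a biholomorphism is a bijection that is holomorphic together with its inverse. The pseudohyperbolic distance on $\mathbb{B}_E$ is $d(z,w)=\|\varphi_w(z)\|$, where \[ \varphi_w(z)=\frac{w-P_wz-(1-\|w\|^2)^{1/2}P_w^\perp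 z}{1-\langle z,w\rangle} \] and $P_w$ is the orthogonal projection onto $\mathbb{C}w$. Theorem. Let $V$ and $W$ be varieties in the open unit balls of complex Hilbert spaces $E$ and $E'$, and suppose that $\phi:\mathcal{M}_V\to\mathcal{M}_W$ is an algebra isomorphism induced by a biholomorphism $F:W\to V$, that is, $\phi(f)=f\circ F$ for all $f\in\mathcal{M}_V$. Then there are constants $c,C>0$ such that \[ c\,d(\lambda,\mu)\le d(F(\lambda),F(\mu))\le C\,d(\lambda,\mu)\quad\text{for all }\lambda,\mu\in W. \] -/

import Mathlib

open scoped ComplexConjugate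

noncomputable section

namespace DruryArveson

/-- The open unit ball of a complex Hilbert space. -/
abbrev UnitBall (E : Type*) [NormedAddCommGroup E] : Type _ :=
  ↥(Metric.ball (0 : E) 1)

section Kernel

variable (E : Type*) [NormedAddCommGroup E] [InnerProductSpace ℂ E]

/-- The reproducing kernel `k(x, y) = 1 / (1 - ⟨x, y⟩)`, where `⟨x, y⟩` is linear in `x`, that is,
`inner ℂ y x` in Mathlib. Scalars are viewed as operators on `ℂ`. -/
def kernel : Matrix (UnitBall E) (UnitBall E) (ℂ →L[ℂ] ℂ) :=
  .of fun x y => (1 - inner ℂ (y : E) (x : E))⁻¹ • 1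

variable {E}

theorem norm_inner_lt_one (x y : UnitBall E) : ‖inner ℂ (x : E) (y : E)‖ < 1 := by
  have hx : ‖(x : E)‖ < 1 := mem_ball_zero_iff.mp x.2
  have hy : ‖(y : E)‖ < 1 := mem_ball_zero_iff.mp y.2
  calc ‖inner ℂ (x : E) (y : E)‖ ≤ ‖(x : E)‖ * ‖(y : E)‖ := norm_inner_le_norm _ _
    _ < 1 := by nlinarith [norm_nonneg (x : E), norm_nonneg (y : E)]

open scoped ComplexOrder in
theorem posSemidef_pow {ι : Type*} [Finite ι] (v : ι → E) (n : ℕ) :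
    (Matrix.of fun i j => (inner ℂ (v i) (v j)) ^ n).PosSemidef := by
  induction n with
  | zero =>
    convert! Matrix.posSemidef_gram ℂ (fun _ : ι => (1 : ℂ)) using 1
    ext i j
    simp [Matrix.gram]
  | succ n ih =>
    convert! ih.hadamard (Matrix.posSemidef_gram ℂ v) using 1

open scoped ComplexOrder in
theorem sum_pow_nonneg (s : Finset (UnitBall E)) (w : UnitBall E → ℂ) (n : ℕ) :
    0 ≤ (∑ x ∈ s, ∑ y ∈ s, conj (w x) * (inner ℂ (y : E) (x : E)) ^ n * w y).re := by
  have h := (posSemidef_pow (fun i : s => ((i : UnitBall E) : E)) n).transpose.dotProduct_mulVec_nonneg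
    (fun i => w i)
  have h' := (Complex.le_def.mp h).1
  simp only [dotProduct, Matrix.mulVec, Pi.star_apply, Matrix.transpose_apply, Matrix.of_apply, Finset.mul_sum] at h'
  rw [← Finset.sum_coe_sort]
  simp only [← Finset.sum_coe_sort s (fun y => conj (w _) * (inner ℂ (y : E) _) ^ n * w y)]
  simpa [mul_assoc] using h'

theorem kernel_posSemidef : (kernel E).PosSemidef := by
  have h := (RKHS.posSemidef_tfae (K := kernel E)).out 0 2
  refine h.mpr (And.intro ?_ fun vv => ?_)
  · ext x y
    simp [kernel, Matrix.conjTranspose_apply]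
  · have key : HasSum (fun n : ℕ => ∑ x ∈ vv.support, ∑ x' ∈ vv.support,
        conj (vv x) * (inner ℂ (x' : E) (x : E)) ^ n * vv x')
        (vv.sum fun x w => vv.sum fun x' w' => inner ℂ (kernel E x' x w) w') := by
      refine hasSum_sum fun x _ => hasSum_sum fun x' _ => ?_
      have h := ((hasSum_geometric_of_norm_lt_one
        (norm_inner_lt_one x' x)).mul_left (conj (vv x))).mul_right (vv x')
      convert! h using 1
      simp [kernel]
      ring
    exact (Complex.hasSum_re key).nonneg fun n => sum_pow_nonneg vv.support vv n

instance : Fact (kernel E).PosSemidef := ⟨kernel_posSemidef⟩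

end Kernel

section Spaces

variable (E : Type*) [NormedAddCommGroup E] [InnerProductSpace ℂ E]

/-- Drury--Arveson space: the Hilbert space of functions on the unit ball of `E` with reproducing
kernel `1 / (1 - ⟨x, y⟩)`. -/
abbrev Space : Type _ := RKHS.OfKernel (kernel E)

variable {E}

/-- The kernel function `k_y`. -/
def kernelFun (y : UnitBall E) : Space E := RKHS.kerFun (Space E) y 1

theorem kernelFun_apply (x y : UnitBall E) :
    kernelFun y x = 1 / (1 - inner ℂ (y : E) (x : E)) := by
  rw [kernelFun, RKHS.kerFun_apply, RKHS.OfKernel.kernel_ofKernel]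
  simp [kernel]

/-- The closed subspace `H_V` of Drury--Arveson space spanned by the kernel functions `k_y`,
`y ∈ V`. -/
def subspaceOf (V : Set (UnitBall E)) : Submodule ℂ (Space E) :=
  (Submodule.span ℂ (kernelFun '' V)).topologicalClosure

/-- Drury--Arveson space as a space of functions on the ball. -/
def functions (E : Type*) [NormedAddCommGroup E] [InnerProductSpace ℂ E] :
    Submodule ℂ (UnitBall E → ℂ) :=
  LinearMap.range (RKHS.coeCLM ℂ : Space E →L[ℂ] (UnitBall E → ℂ)).toLinearMap

/-- The space `H_V` as a space of functions on `V`. -/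
def functionsOn (V : Set (UnitBall E)) : Submodule ℂ (V → ℂ) :=
  (subspaceOf V).map ((LinearMap.funLeft ℂ ℂ (Subtype.val : V → UnitBall E)).comp
    (RKHS.coeCLM ℂ : Space E →L[ℂ] (UnitBall E → ℂ)).toLinearMap)

end Spaces

/-- The algebra of multipliers of a space `H` of complex functions on `X`: all functions `f`
on `X` with `f * h ∈ H` for all `h ∈ H`. -/
def multipliers {X : Type*} (H : Submodule ℂ (X → ℂ)) : Subalgebra ℂ (X → ℂ) where
  carrier := {f | ∀ h ∈ H, f * h ∈ H}
  mul_mem' {f g} hf hg h hh := by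
    rw [mul_assoc]
    exact hf _ (hg _ hh)
  add_mem' {f g} hf hg h hh := by
    rw [add_mul]
    exact H.add_mem (hf _ hh) (hg _ hh)
  algebraMap_mem' c h hh := by
    rw [← Algebra.smul_def]
    exact H.smul_mem c hh

section Varieties

variable {E : Type*} [NormedAddCommGroup E] [InnerProductSpace ℂ E]

/-- A variety: the common zero set in the ball of a family of multipliers of Drury--Arveson
space. -/
def IsVariety (V : Set (UnitBall E)) : Prop :=
  ∃ S : Set (UnitBall E → ℂ), S ⊆ multipliers (functions E) ∧ V = {z | ∀ h ∈ S, h z = 0}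

/-- The multiplier algebra `M_V` of `H_V`, an algebra of functions on `V`. -/
abbrev multiplierAlgebra (V : Set (UnitBall E)) : Subalgebra ℂ (V → ℂ) :=
  multipliers (functionsOn V)

/-- A map defined on a subset `V` of the ball is holomorphic if it is locally the restriction of
a holomorphic map defined on a ball of the ambient Hilbert space. -/
def HolomorphicOn {E' : Type*} [NormedAddCommGroup E'] [NormedSpace ℂ E']
    (V : Set (UnitBall E)) (F : V → E') : Prop :=
  ∀ v : V, ∃ r > 0, ∃ g : E → E', DifferentiableOn ℂ g (Metric.ball ((v : UnitBall E) : E) r) ∧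
    ∀ u : V, ((u : UnitBall E) : E) ∈ Metric.ball ((v : UnitBall E) : E) r →
      g ((u : UnitBall E) : E) = F u

/-- A biholomorphism: a bijection that is holomorphic together with its inverse. -/
def IsBiholomorphism {E' : Type*} [NormedAddCommGroup E'] [InnerProductSpace ℂ E']
    {W : Set (UnitBall E)} {V : Set (UnitBall E')} (F : W ≃ V) : Prop :=
  HolomorphicOn W (fun w => ((F w : UnitBall E') : E')) ∧
    HolomorphicOn V (fun v => ((F.symm v : UnitBall E) : E))

/-- The conformal automorphism `φ_w` of the ball interchanging `w` and `0`:
`φ_w(z) = (w - P_w z - (1 - ‖w‖²)^{1/2} P_w^⊥ z) / (1 - ⟨z, w⟩)`, with `P_w` the orthogonal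
projection onto `ℂ w`. -/
def ballAut (w z : E) : E :=
  (1 - inner ℂ w z)⁻¹ •
    (w - (ℂ ∙ w).starProjection z
      - ((Real.sqrt (1 - ‖w‖ ^ 2) : ℝ) : ℂ) • (z - (ℂ ∙ w).starProjection z))

/-- The pseudohyperbolic distance `d(z, w) = ‖φ_w(z)‖` on the unit ball. -/
def pseudohyperbolicDist (z w : UnitBall E) : ℝ := ‖ballAut (w : E) (z : E)‖

end Varieties

end DruryArveson

end

/-! The pseudohyperbolic distance is extremal for multipliers. A multiplier vanishing at `w` is
bounded at `z` by its operator norm times d(z, w) (`IsMultiplicationBy.norm_sq_le`,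
`pseudohyperbolicDist_sq`). Conversely, pairing φ_w with a unit vector gives a contractive
multiplier vanishing at `w` (`exists_isMultiplicationBy_inner_ballAut`), and the vector along φ_w(z)
makes its modulus at `z` equal to d(z, w). Composition with `F` is bounded in operator norm by the
closed graph theorem (`exists_norm_bound_comp`). Pulling back to `W` the function extremal for F(λ),
F(μ) therefore gives the upper estimate; the lower one is the same argument for the inverse of `F`.
-/

noncomputable section

namespace DruryArveson

/-! ### Multipliers of an abstract family of kernel vectors -/

section AbstractMultipliers

variable {X Y K L : Type*}
  [NormedAddCommGroup K] [InnerProductSpace ℂ K]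
  [NormedAddCommGroup L] [InnerProductSpace ℂ L]

/-- `T` acts as multiplication by `f` on the functions `x ↦ ⟪k x, h⟫`, `h ∈ K`. -/
def IsMultiplicationBy (k : X → K) (f : X → ℂ) (T : K →L[ℂ] K) : Prop :=
  ∀ x h, inner ℂ (k x) (T h) = f x * inner ℂ (k x) h

theorem eq_zero_of_inner_kernel {k : X → K} (hk : DenseRange (Finsupp.linearCombination ℂ k))
    {h : K} (hh : ∀ x, inner ℂ (k x) h = 0) : h = 0 := by
  refine hk.eq_zero_of_inner_right ℂ fun c => ?_
  rw [Finsupp.linearCombination_apply, Finsupp.sum_inner]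
  exact Finset.sum_eq_zero fun x _ => by
    change inner ℂ (c x • k x) h = 0
    rw [inner_smul_left, hh, mul_zero]

theorem eq_of_inner_kernel {k : X → K} (hk : DenseRange (Finsupp.linearCombination ℂ k))
    {g h : K} (hh : ∀ x, inner ℂ (k x) g = inner ℂ (k x) h) : g = h :=
  sub_eq_zero.mp <| eq_zero_of_inner_kernel hk fun x => by
    rw [inner_sub_right, hh, sub_self]

theorem IsMultiplicationBy.unique {k : X → K}
    (hk : DenseRange (Finsupp.linearCombination ℂ k)) {f : X → ℂ} {S T : K →L[ℂ] K}
    (hS : IsMultiplicationBy k f S) (hT : IsMultiplicationBy k f T) : S = T :=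
  ContinuousLinearMap.ext fun h => eq_of_inner_kernel hk fun x => by rw [hS, hT]

theorem IsMultiplicationBy.add {k : X → K} {f g : X → ℂ} {S T : K →L[ℂ] K}
    (hS : IsMultiplicationBy k f S) (hT : IsMultiplicationBy k g T) :
    IsMultiplicationBy k (f + g) (S + T) := fun x h => by
  simp only [FunLike.coe_add, Pi.add_apply, inner_add_right, add_mul, hS x h, hT x h]

theorem IsMultiplicationBy.smul {k : X → K} {f : X → ℂ} {T : K →L[ℂ] K} (c : ℂ)
    (hT : IsMultiplicationBy k f T) : IsMultiplicationBy k (c • f) (c • T) := fun x h => by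
  simp only [FunLike.coe_smul, Pi.smul_apply, inner_smul_right, hT x h, smul_eq_mul, mul_assoc]

/-- Multipliers act as bounded operators. -/
theorem exists_isMultiplicationBy [CompleteSpace K] {k : X → K}
    (hk : DenseRange (Finsupp.linearCombination ℂ k)) {f : X → ℂ}
    (hf : ∀ h, ∃ g, ∀ x, inner ℂ (k x) g = f x * inner ℂ (k x) h) :
    ∃ T, IsMultiplicationBy k f T := by
  choose M hM using hf
  let T : K →ₗ[ℂ] K :=
    { toFun := M
      map_add' := fun a b => eq_of_inner_kernel hk fun x => by
        rw [inner_add_right, hM, hM, hM, inner_add_right, mul_add]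
      map_smul' := fun c a => eq_of_inner_kernel hk fun x => by
        rw [RingHom.id_apply, inner_smul_right, hM, hM, inner_smul_right]; ring }
  -- Closed graph theorem: norm convergence implies pointwise convergence, which determines the
  -- limit.
  refine ⟨ContinuousLinearMap.ofSeqClosedGraph (g := T) ?_, fun x h => hM h x⟩
  intro u a b hu hTu
  refine eq_of_inner_kernel hk fun x => ?_
  change inner ℂ (k x) b = inner ℂ (k x) (M a)
  rw [hM]
  have h1 : Filter.Tendsto (fun n => inner ℂ (k x) (T (u n))) Filter.atTop
      (nhds (inner ℂ (k x) b)) := (tendsto_const_nhds (x := k x)).inner hTu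
  have h2 : Filter.Tendsto (fun n => f x * inner ℂ (k x) (u n)) Filter.atTop
      (nhds (f x * inner ℂ (k x) a)) :=
    ((tendsto_const_nhds (x := k x)).inner hu).const_mul (f x)
  exact tendsto_nhds_unique h1 (h2.congr fun n => (hM (u n) x).symm)

/-- The space of bounded operators that act as multiplication by a function. -/
def multiplicationOps (k : X → K) : Submodule ℂ (K →L[ℂ] K) where
  -- Testing on `k x` eliminates the multiplying function; what remains is linear and continuous in
  -- `T`, so the space is closed, hence Banach when `K` is complete.
  carrier := {T | ∀ x h, inner ℂ (k x) (T h) * inner ℂ (k x) (k x) =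
    inner ℂ (k x) (T (k x)) * inner ℂ (k x) h}
  zero_mem' x h := by simp
  add_mem' {S T} hS hT x h := by
    simp only [FunLike.coe_add, Pi.add_apply, inner_add_right, add_mul]
    rw [hS x h, hT x h]
  smul_mem' c T hT x h := by
    simp only [FunLike.coe_smul, Pi.smul_apply, inner_smul_right, mul_assoc]
    rw [hT x h]

theorem isClosed_multiplicationOps (k : X → K) :
    IsClosed (multiplicationOps k : Set (K →L[ℂ] K)) := by
  change IsClosed {T : K →L[ℂ] K | ∀ x h, inner ℂ (k x) (T h) * inner ℂ (k x) (k x) =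
    inner ℂ (k x) (T (k x)) * inner ℂ (k x) h}
  simp only [Set.ofPred_forall]
  refine isClosed_iInter fun x => isClosed_iInter fun h => isClosed_eq ?_ ?_ <;> fun_prop

/-- The function by which an operator in `multiplicationOps k` multiplies. -/
def symbol (k : X → K) (T : K →L[ℂ] K) (x : X) : ℂ :=
  inner ℂ (k x) (T (k x)) / inner ℂ (k x) (k x)

theorem isMultiplicationBy_symbol {k : X → K} (h0 : ∀ x, k x ≠ 0) {T : K →L[ℂ] K}
    (hT : T ∈ multiplicationOps k) : IsMultiplicationBy k (symbol k T) T := fun x h => by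
  have : inner ℂ (k x) (k x) ≠ 0 := inner_self_ne_zero.mpr (h0 x)
  rw [symbol, div_mul_eq_mul_div, eq_div_iff this]
  exact hT x h

theorem IsMultiplicationBy.mem_multiplicationOps {k : X → K} {f : X → ℂ} {T : K →L[ℂ] K}
    (hT : IsMultiplicationBy k f T) : T ∈ multiplicationOps k := fun x h => by
  rw [hT, hT]; ring

theorem IsMultiplicationBy.symbol_eq {k : X → K} (h0 : ∀ x, k x ≠ 0) {f : X → ℂ}
    {T : K →L[ℂ] K} (hT : IsMultiplicationBy k f T) : symbol k T = f := by
  ext x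
  rw [symbol, hT, mul_div_cancel_right₀ _ (inner_self_ne_zero.mpr (h0 x))]

theorem continuous_symbol (k : X → K) (x : X) : Continuous fun T => symbol k T x := by
  unfold symbol
  fun_prop

/-- If composition with `G` maps multipliers to multipliers, it does so boundedly. -/
theorem exists_norm_bound_comp [CompleteSpace K] [CompleteSpace L] {k : X → K}
    (hk0 : ∀ x, k x ≠ 0) {l : Y → L} (hl : DenseRange (Finsupp.linearCombination ℂ l))
    (hl0 : ∀ y, l y ≠ 0) (G : Y → X)
    (hG : ∀ f T, IsMultiplicationBy k f T → ∃ S, IsMultiplicationBy l (f ∘ G) S) :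
    ∃ C, 0 ≤ C ∧ ∀ f T, IsMultiplicationBy k f T →
      ∃ S, IsMultiplicationBy l (f ∘ G) S ∧ ‖S‖ ≤ C * ‖T‖ := by
  have : CompleteSpace (multiplicationOps k) :=
    (isClosed_multiplicationOps k).completeSpace_coe
  have : CompleteSpace (multiplicationOps l) :=
    (isClosed_multiplicationOps l).completeSpace_coe
  choose Φ hΦ using fun T : multiplicationOps k =>
    hG _ _ (isMultiplicationBy_symbol hk0 T.2)
  let Ψ : multiplicationOps k →ₗ[ℂ] multiplicationOps l :=
    { toFun := fun T => ⟨Φ T, (hΦ T).mem_multiplicationOps⟩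
      map_add' := fun S T => Subtype.ext <| (hΦ (S + T)).unique hl <| by
        have h := ((isMultiplicationBy_symbol hk0 S.2).add
          (isMultiplicationBy_symbol hk0 T.2)).symbol_eq hk0
        rw [Submodule.coe_add, h]
        exact (hΦ S).add (hΦ T)
      map_smul' := fun c T => Subtype.ext <| (hΦ (c • T)).unique hl <| by
        have h := ((isMultiplicationBy_symbol hk0 T.2).smul c).symbol_eq hk0
        rw [Submodule.coe_smul, h]
        exact (hΦ T).smul c }
  let Ψ' : multiplicationOps k →L[ℂ] multiplicationOps l :=
    ContinuousLinearMap.ofSeqClosedGraph (g := Ψ) <| by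
      intro u a b hu hΨu
      -- The limit `b` has symbol `symbol k a ∘ G`, because symbols converge pointwise on both
      -- sides.
      refine Subtype.ext <| IsMultiplicationBy.unique hl (f := symbol k a ∘ G) ?_ (hΦ a)
      convert! isMultiplicationBy_symbol hl0 b.2 using 1
      ext y
      have h1 := (((continuous_symbol k (G y)).comp continuous_subtype_val).tendsto a).comp hu
      have h2 := (((continuous_symbol l y).comp continuous_subtype_val).tendsto b).comp hΨu
      refine tendsto_nhds_unique (h1.congr fun n => ?_) h2
      exact (congrFun ((hΦ (u n)).symbol_eq hl0) y).symm
  refine ⟨‖Ψ'‖, Ψ'.opNorm_nonneg, fun f T hT => ⟨Φ ⟨T, hT.mem_multiplicationOps⟩, ?_, ?_⟩⟩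
  · have h := hΦ ⟨T, hT.mem_multiplicationOps⟩
    rwa [hT.symbol_eq hk0] at h
  · exact Ψ'.le_opNorm ⟨T, hT.mem_multiplicationOps⟩

/-- The Schwarz--Pick inequality for a multiplier vanishing at `y`. -/
theorem IsMultiplicationBy.norm_sq_le {k : X → K} (h0 : ∀ x, k x ≠ 0) {f : X → ℂ}
    {T : K →L[ℂ] K} (hT : IsMultiplicationBy k f T) {x y : X} (hy : f y = 0) :
    ‖f x‖ ^ 2 ≤ ‖T‖ ^ 2 *
      (1 - ‖inner ℂ (k y) (k x)‖ ^ 2 / (‖k x‖ ^ 2 * ‖k y‖ ^ 2)) := by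
  have hx0 : 0 < ‖k x‖ := norm_pos_iff.mpr (h0 x)
  have hy0 : 0 < ‖k y‖ := norm_pos_iff.mpr (h0 y)
  have hyy : (inner ℂ (k y) (k y) : ℂ) ≠ 0 := inner_self_ne_zero.mpr (h0 y)
  set c : ℂ := inner ℂ (k y) (k x) / inner ℂ (k y) (k y) with hc
  -- The component of `k x` orthogonal to `k y`; its relative squared length is the last factor of
  -- the bound.
  set p : K := k x - c • k y with hp
  have hpy : inner ℂ (k y) p = 0 := by
    rw [hp, inner_sub_right, inner_smul_right, hc, div_mul_cancel₀ _ hyy, sub_self]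
  have hcn : ‖c‖ * ‖k y‖ ^ 2 = ‖inner ℂ (k y) (k x)‖ := by
    rw [hc, norm_div, inner_self_eq_norm_sq_to_K]
    simp only [Complex.coe_algebraMap, norm_pow, Complex.norm_real, norm_norm]
    field_simp
  have hpn : ‖p‖ ^ 2 + ‖c‖ ^ 2 * ‖k y‖ ^ 2 = ‖k x‖ ^ 2 := by
    have h : k x = p + c • k y := by rw [hp]; abel
    have h' : inner ℂ p (c • k y) = 0 := by
      rw [inner_smul_right, inner_eq_zero_symm.mp hpy, mul_zero]
    have := norm_add_sq_eq_norm_sq_add_norm_sq_of_inner_eq_zero p (c • k y) h'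
    rw [← h, norm_smul] at this
    nlinarith
  have hle : ‖f x‖ * ‖k x‖ ^ 2 ≤ ‖p‖ * (‖T‖ * ‖k x‖) := by
    -- Since `f y = 0`, the range of `T` is orthogonal to `k y`, so `k x` may be replaced by the
    -- shorter `p`.
    have h1 : inner ℂ p (T (k x)) = f x * inner ℂ (k x) (k x) := by
      rw [hp, inner_sub_left, inner_smul_left, hT y, hy, hT x]; simp
    have h2 := norm_inner_le_norm (𝕜 := ℂ) p (T (k x))
    rw [h1, norm_mul, inner_self_eq_norm_sq_to_K] at h2
    simp only [Complex.coe_algebraMap, norm_pow, Complex.norm_real, norm_norm] at h2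
    exact h2.trans (by gcongr; exact T.le_opNorm _)
  have hle' : ‖f x‖ * ‖k x‖ ≤ ‖p‖ * ‖T‖ := by
    refine le_of_mul_le_mul_right ?_ hx0
    linarith
  have hsq : ‖f x‖ ^ 2 * ‖k x‖ ^ 2 ≤ ‖T‖ ^ 2 * ‖p‖ ^ 2 := by
    have := pow_le_pow_left₀ (by positivity) hle' 2
    linarith [mul_pow ‖f x‖ ‖k x‖ 2, mul_pow ‖p‖ ‖T‖ 2]
  have hpq : ‖p‖ ^ 2 =
      (1 - ‖inner ℂ (k y) (k x)‖ ^ 2 / (‖k x‖ ^ 2 * ‖k y‖ ^ 2)) * ‖k x‖ ^ 2 := by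
    rw [← hcn]
    field_simp
    linarith
  rw [hpq, ← mul_assoc] at hsq
  exact le_of_mul_le_mul_right hsq (by positivity)

theorem norm_linearCombination_sq (k : X → K) (c : X →₀ ℂ) :
    (‖Finsupp.linearCombination ℂ k c‖ ^ 2 : ℂ) =
      ∑ i : c.support, ∑ j : c.support, conj (c i) * inner ℂ (k i) (k j) * c j := by
  have h := inner_self_eq_norm_sq_to_K (𝕜 := ℂ) (Finsupp.linearCombination ℂ k c)
  simp only [Complex.coe_algebraMap] at h
  rw [← h, Finsupp.linearCombination_apply, Finsupp.sum, sum_inner,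
    ← Finset.sum_coe_sort]
  refine Finset.sum_congr rfl fun i _ => ?_
  rw [inner_sum, ← Finset.sum_coe_sort]
  refine Finset.sum_congr rfl fun j _ => ?_
  rw [inner_smul_left, inner_smul_right]
  ring

open scoped ComplexOrder in
/-- A function `f` with `(1 - f(x) conj f(y)) k(x, y)` positive semidefinite is a contractive
multiplier. -/
theorem exists_isMultiplicationBy_norm_le_one [CompleteSpace K] {k : X → K}
    (hk : DenseRange (Finsupp.linearCombination ℂ k)) {f : X → ℂ}
    (hf : ∀ s : Finset X, (Matrix.of fun i j : s =>
      inner ℂ (k i) (k j) * (1 - f i * conj (f j))).PosSemidef) :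
    ∃ T, IsMultiplicationBy k f T ∧ ‖T‖ ≤ 1 := by
  -- The adjoint of a multiplication operator must send `k x` to `conj (f x) • k x`. Positivity says
  -- that this prescription is contractive on the span, so it extends to `K`.
  set A : (X →₀ ℂ) →ₗ[ℂ] K := Finsupp.linearCombination ℂ fun x => conj (f x) • k x with hA
  set B : (X →₀ ℂ) →ₗ[ℂ] K := Finsupp.linearCombination ℂ k with hB
  have hAB : ∀ c, ‖A c‖ ≤ 1 * ‖B c‖ := fun c => by
    rw [one_mul]
    refine (sq_le_sq₀ (norm_nonneg _) (norm_nonneg _)).mp ?_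
    have h := (hf c.support).dotProduct_mulVec_nonneg (fun i => c i)
    have h2 : star (fun i : c.support => c i) ⬝ᵥ ((Matrix.of fun i j : c.support =>
        inner ℂ (k i) (k j) * (1 - f i * conj (f j))).mulVec fun i => c i) =
        ((‖B c‖ ^ 2 - ‖A c‖ ^ 2 : ℝ) : ℂ) := by
      push_cast
      rw [hA, hB, norm_linearCombination_sq, norm_linearCombination_sq,
        ← Finset.sum_sub_distrib]
      simp only [dotProduct, Matrix.mulVec, Pi.star_apply, Matrix.of_apply, Finset.mul_sum]
      refine Finset.sum_congr rfl fun i _ => ?_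
      rw [← Finset.sum_sub_distrib]
      refine Finset.sum_congr rfl fun j _ => ?_
      rw [inner_smul_left, inner_smul_right, Complex.conj_conj, Complex.star_def]
      ring
    rw [h2] at h
    have := Complex.zero_le_real.mp h
    linarith
  have hT : ∀ x, A.extendOfNorm B (k x) = conj (f x) • k x := fun x => by
    have := LinearMap.extendOfNorm_eq hk ⟨1, hAB⟩ (Finsupp.single x 1)
    simpa [hA, hB] using this
  refine ⟨(A.extendOfNorm B).adjoint, fun x h => ?_, ?_⟩
  · rw [ContinuousLinearMap.adjoint_inner_right, hT, inner_smul_left, Complex.conj_conj]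
  · rw [LinearIsometryEquiv.norm_map]
    exact LinearMap.opNorm_extendOfNorm_le hk zero_le_one hAB

end AbstractMultipliers

/-! ### The fundamental identity for ball automorphisms -/

section BallAut

theorem norm_sq_lt_one {E : Type*} [NormedAddCommGroup E] (x : UnitBall E) : ‖(x : E)‖ ^ 2 < 1 := by
  have hx : ‖(x : E)‖ < 1 := mem_ball_zero_iff.mp x.2
  nlinarith [norm_nonneg (x : E)]

theorem sqrt_one_sub_norm_sq_mul_self {E : Type*} [NormedAddCommGroup E] (a : UnitBall E) :
    ((Real.sqrt (1 - ‖(a : E)‖ ^ 2) : ℝ) : ℂ) * (Real.sqrt (1 - ‖(a : E)‖ ^ 2) : ℝ) =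
      1 - (‖(a : E)‖ : ℂ) ^ 2 := by
  rw [← Complex.ofReal_mul, Real.mul_self_sqrt (by linarith [norm_sq_lt_one a])]
  push_cast
  rfl

variable {E : Type*} [NormedAddCommGroup E] [InnerProductSpace ℂ E]

theorem one_sub_inner_ne_zero (x y : UnitBall E) : 1 - inner ℂ (x : E) (y : E) ≠ 0 := by
  intro h
  have := norm_inner_lt_one x y
  rw [← sub_eq_zero.mp h, norm_one] at this
  exact lt_irrefl _ this

theorem ballAut_self (a : E) : ballAut a a = 0 := by
  rw [ballAut, Submodule.starProjection_eq_self_iff.mpr (Submodule.mem_span_singleton_self a)]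
  simp

/-- Used twice: on the diagonal it computes the pseudohyperbolic distance, and off it, it makes the
kernel times this expression a rank-one kernel. -/
theorem inner_ballAut (a w z : UnitBall E) :
    1 - inner ℂ (ballAut (a : E) (w : E)) (ballAut (a : E) (z : E)) =
      (1 - (‖(a : E)‖ : ℂ) ^ 2) * (1 - inner ℂ (w : E) (z : E)) /
        ((1 - inner ℂ (w : E) (a : E)) * (1 - inner ℂ (a : E) (z : E))) := by
  have h1 := one_sub_inner_ne_zero w a
  have h2 := one_sub_inner_ne_zero a z
  have hs := sqrt_one_sub_norm_sq_mul_self a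
  rw [eq_div_iff (mul_ne_zero h1 h2)]
  simp only [ballAut, Submodule.starProjection_singleton, inner_smul_left, inner_smul_right,
    inner_sub_left, inner_sub_right, map_inv₀, map_sub, map_one, map_div₀, inner_conj_symm,
    Complex.conj_ofReal, inner_self_eq_norm_sq_to_K, map_pow, Complex.coe_algebraMap]
  generalize ((Real.sqrt (1 - ‖(a : E)‖ ^ 2) : ℝ) : ℂ) = s at hs
  -- The projection formula divides by `‖a‖ ^ 2`.
  by_cases ha : (a : E) = 0
  · simp only [ha, norm_zero, inner_zero_left, inner_zero_right] at hs ⊢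
    simp only [Complex.ofReal_zero, ne_eq, OfNat.ofNat_ne_zero, not_false_eq_true, zero_pow] at hs ⊢
    linear_combination (-inner ℂ (w : E) (z : E)) * hs
  · have hn : (‖(a : E)‖ : ℂ) ≠ 0 := by simpa using ha
    field_simp
    linear_combination (inner ℂ (w : E) (a : E) * inner ℂ (a : E) (z : E) -
      inner ℂ (w : E) (z : E) * (‖(a : E)‖ : ℂ) ^ 2) * hs

end BallAut

/-! ### Drury–Arveson kernels and the Lipschitz estimate -/

section Concrete

variable {E : Type*} [NormedAddCommGroup E] [InnerProductSpace ℂ E]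

theorem inner_kernelFun_left (y : UnitBall E) (h : Space E) : inner ℂ (kernelFun y) h = h y := by
  rw [kernelFun, RKHS.kerFun_inner]
  simp

instance (V : Set (UnitBall E)) : CompleteSpace (subspaceOf V) :=
  (Submodule.isClosed_topologicalClosure _).completeSpace_coe

/-- The kernel functions of the points of `V`, as elements of `H_V`. -/
def kernelOn (V : Set (UnitBall E)) (x : V) : subspaceOf V :=
  ⟨kernelFun x, Submodule.le_topologicalClosure _ (Submodule.subset_span ⟨x, x.2, rfl⟩)⟩

theorem inner_kernelOn_left {V : Set (UnitBall E)} (x : V) (h : subspaceOf V) :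
    inner ℂ (kernelOn V x) h = (h : Space E) x :=
  inner_kernelFun_left _ _

theorem inner_kernelOn {V : Set (UnitBall E)} (x y : V) :
    inner ℂ (kernelOn V x) (kernelOn V y) =
      (1 - inner ℂ ((y : UnitBall E) : E) ((x : UnitBall E) : E))⁻¹ := by
  rw [inner_kernelOn_left, ← one_div]
  exact kernelFun_apply _ _

theorem kernelOn_ne_zero {V : Set (UnitBall E)} (x : V) : kernelOn V x ≠ 0 := by
  rw [← inner_self_ne_zero (𝕜 := ℂ), inner_kernelOn]
  exact inv_ne_zero (one_sub_inner_ne_zero _ _)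

theorem norm_kernelOn_sq {V : Set (UnitBall E)} (x : V) :
    ‖kernelOn V x‖ ^ 2 = (1 - ‖((x : UnitBall E) : E)‖ ^ 2)⁻¹ := by
  have h := inner_self_eq_norm_sq_to_K (𝕜 := ℂ) (kernelOn V x)
  rw [inner_kernelOn, inner_self_eq_norm_sq_to_K] at h
  simp only [Complex.coe_algebraMap] at h
  exact_mod_cast h.symm

theorem denseRange_kernelOn (V : Set (UnitBall E)) :
    DenseRange (Finsupp.linearCombination ℂ (kernelOn V)) := by
  intro h
  rw [closure_subtype]
  refine closure_mono ?_ h.2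
  change (Submodule.span ℂ (kernelFun '' V) : Set (Space E)) ⊆
    ((LinearMap.range (Finsupp.linearCombination ℂ (kernelOn V))).map (subspaceOf V).subtype :
      Set (Space E))
  rw [SetLike.coe_subset_coe, Submodule.span_le]
  rintro _ ⟨x, hx, rfl⟩
  exact ⟨kernelOn V ⟨x, hx⟩, ⟨Finsupp.single ⟨x, hx⟩ 1, by simp⟩, rfl⟩

theorem mem_multiplierAlgebra_iff {V : Set (UnitBall E)} {f : V → ℂ} :
    f ∈ multiplierAlgebra V ↔ ∃ T, IsMultiplicationBy (kernelOn V) f T := by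
  constructor
  · intro hf
    refine exists_isMultiplicationBy (denseRange_kernelOn V) fun h => ?_
    obtain ⟨g, hg, hgf⟩ := hf _ ⟨h, h.2, rfl⟩
    refine ⟨⟨g, hg⟩, fun x => ?_⟩
    rw [inner_kernelOn_left, inner_kernelOn_left]
    exact congrFun hgf x
  · rintro ⟨T, hT⟩ _ ⟨h, hh, rfl⟩
    refine ⟨T ⟨h, hh⟩, (T ⟨h, hh⟩).2, funext fun x => ?_⟩
    have := hT x ⟨h, hh⟩
    rwa [inner_kernelOn_left, inner_kernelOn_left] at this

open scoped ComplexOrder in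
/-- The components of the ball automorphisms are contractive multipliers. -/
theorem exists_isMultiplicationBy_inner_ballAut (V : Set (UnitBall E)) (a : UnitBall E)
    {u : E} (hu : ‖u‖ = 1) :
    ∃ T, IsMultiplicationBy (kernelOn V)
      (fun x : V => inner ℂ u (ballAut (a : E) ((x : UnitBall E) : E))) T ∧ ‖T‖ ≤ 1 := by
  refine exists_isMultiplicationBy_norm_le_one (denseRange_kernelOn V) fun s => ?_
  let b : s → E := fun i => ballAut (a : E) ((i : V) : UnitBall E)
  let g : s → ℂ := fun i => (Real.sqrt (1 - ‖(a : E)‖ ^ 2) : ℝ) *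
    (1 - inner ℂ ((i : V) : E) (a : E))⁻¹
  have hs := sqrt_one_sub_norm_sq_mul_self a
  -- With `f = ⟨b, u⟩`, split `1 - f i * conj (f j)` into `1 - ⟨b i, b j⟩` plus the Gram matrix of
  -- the parts of `b` orthogonal to `u`. Times the kernel, the first is rank one by `inner_ballAut`,
  -- the second a Schur product.
  have h1 := Matrix.posSemidef_gram ℂ g
  have h2 := (Matrix.posSemidef_gram ℂ fun i : s => kernelOn V i).hadamard
    (Matrix.posSemidef_gram ℂ fun i => b i - inner ℂ u (b i) • u).transpose
  convert! h1.add h2 using 1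
  ext i j
  simp only [Matrix.of_apply, Matrix.add_apply, Matrix.hadamard_apply, Matrix.gram_apply,
    Matrix.transpose_apply, RCLike.inner_apply]
  have h3 : inner ℂ (b j - inner ℂ u (b j) • u) (b i - inner ℂ u (b i) • u) =
      inner ℂ (b j) (b i) - inner ℂ u (b i) * conj (inner ℂ u (b j)) := by
    have huu : inner ℂ u u = (1 : ℂ) := by rw [inner_self_eq_norm_sq_to_K, hu]; simp
    simp only [inner_sub_left, inner_sub_right, inner_smul_left, inner_smul_right, huu,
      inner_conj_symm]
    ring
  have h4 : inner ℂ (kernelOn V i) (kernelOn V j) * (1 - inner ℂ (b j) (b i)) =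
      g j * conj (g i) := by
    have h5 := one_sub_inner_ne_zero ((j : V) : UnitBall E) ((i : V) : UnitBall E)
    have h6 := one_sub_inner_ne_zero ((j : V) : UnitBall E) a
    have h7 := one_sub_inner_ne_zero a ((i : V) : UnitBall E)
    rw [inner_ballAut, inner_kernelOn]
    simp only [g, map_mul, map_inv₀, map_sub, map_one, inner_conj_symm, Complex.conj_ofReal]
    field_simp
    rw [← hs]; ring
  rw [h3, ← h4]
  ring

theorem pseudohyperbolicDist_sq {V : Set (UnitBall E)} (x y : V) :
    pseudohyperbolicDist (x : UnitBall E) y ^ 2 =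
      1 - ‖inner ℂ (kernelOn V y) (kernelOn V x)‖ ^ 2 /
        (‖kernelOn V x‖ ^ 2 * ‖kernelOn V y‖ ^ 2) := by
  have h := inner_ballAut (y : UnitBall E) x x
  have h1 := one_sub_inner_ne_zero (x : UnitBall E) y
  have hc : 1 - inner ℂ ((y : UnitBall E) : E) ((x : UnitBall E) : E) =
      conj (1 - inner ℂ ((x : UnitBall E) : E) ((y : UnitBall E) : E)) := by simp
  rw [hc, Complex.mul_conj, Complex.normSq_eq_norm_sq, inner_self_eq_norm_sq_to_K,
    inner_self_eq_norm_sq_to_K] at h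
  simp only [Complex.coe_algebraMap] at h
  have h' : 1 - pseudohyperbolicDist (x : UnitBall E) y ^ 2 =
      (1 - ‖((y : UnitBall E) : E)‖ ^ 2) * (1 - ‖((x : UnitBall E) : E)‖ ^ 2) /
        ‖1 - inner ℂ ((x : UnitBall E) : E) ((y : UnitBall E) : E)‖ ^ 2 := by
    rw [pseudohyperbolicDist]
    exact_mod_cast h
  rw [inner_kernelOn, norm_kernelOn_sq, norm_kernelOn_sq, norm_inv]
  rw [eq_sub_iff_add_eq, ← eq_sub_iff_add_eq', h']
  have hn := norm_ne_zero_iff.mpr h1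
  have := norm_sq_lt_one (x : UnitBall E)
  have := norm_sq_lt_one (y : UnitBall E)
  field_simp

/-- A map that pulls multipliers back to multipliers is Lipschitz with respect to the
pseudohyperbolic distances. -/
theorem exists_pseudohyperbolicDist_le {E' : Type*} [NormedAddCommGroup E']
    [InnerProductSpace ℂ E'] {V : Set (UnitBall E)} {W : Set (UnitBall E')} (F : W → V)
    (hF : ∀ f ∈ multiplierAlgebra V, f ∘ F ∈ multiplierAlgebra W) :
    ∃ C : ℝ, 0 < C ∧ ∀ l m : W, pseudohyperbolicDist (F l : UnitBall E) (F m) ≤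
      C * pseudohyperbolicDist (l : UnitBall E') m := by
  obtain ⟨C, hC, H⟩ := exists_norm_bound_comp kernelOn_ne_zero (denseRange_kernelOn W)
    kernelOn_ne_zero F fun f T hT =>
      mem_multiplierAlgebra_iff.mp (hF f (mem_multiplierAlgebra_iff.mpr ⟨T, hT⟩))
  -- `C` may be zero, but the constant must be positive.
  refine ⟨C + 1, by linarith, fun l m => ?_⟩
  set p : E := ballAut ((F m : UnitBall E) : E) ((F l : UnitBall E) : E) with hp
  have hd : 0 ≤ pseudohyperbolicDist (l : UnitBall E') m := norm_nonneg _
  change ‖p‖ ≤ _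
  by_cases hp0 : p = 0
  · rw [hp0, norm_zero]
    positivity
  have hpn : ‖p‖ ≠ 0 := norm_ne_zero_iff.mpr hp0
  have hu : ‖((‖p‖⁻¹ : ℝ) : ℂ) • p‖ = 1 := by
    rw [norm_smul, Complex.norm_real, norm_inv, norm_norm, inv_mul_cancel₀ hpn]
  -- The extremal multiplier for the pair `F l`, `F m`.
  obtain ⟨T, hT, hT1⟩ := exists_isMultiplicationBy_inner_ballAut V (F m) hu
  obtain ⟨S, hS, hSC⟩ := H _ T hT
  have hm := hS.norm_sq_le kernelOn_ne_zero (x := l) (y := m) (by simp [ballAut_self])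
  rw [← pseudohyperbolicDist_sq] at hm
  have hval : ‖inner ℂ (((‖p‖⁻¹ : ℝ) : ℂ) • p) p‖ = ‖p‖ := by
    rw [inner_smul_left, inner_self_eq_norm_sq_to_K]
    simp only [Complex.coe_algebraMap, norm_mul, Complex.conj_ofReal, norm_pow,
      Complex.norm_real, norm_norm, norm_inv]
    field_simp
  simp only [Function.comp_apply, ← hp, hval] at hm
  rw [← mul_pow] at hm
  have hSC' : ‖S‖ ≤ C + 1 := hSC.trans (by nlinarith)
  refine ((sq_le_sq₀ (norm_nonneg _) (by positivity)).mp hm).trans ?_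
  gcongr

end Concrete

end DruryArveson

end

theorem theoremT {E E' : Type*}
    [NormedAddCommGroup E] [InnerProductSpace ℂ E] [CompleteSpace E]
    [NormedAddCommGroup E'] [InnerProductSpace ℂ E'] [CompleteSpace E']
    (V : Set (DruryArveson.UnitBall E)) (W : Set (DruryArveson.UnitBall E'))
    (hV : DruryArveson.IsVariety V) (hW : DruryArveson.IsVariety W)
    (F : W ≃ V) (hF : DruryArveson.IsBiholomorphism F)
    (φ : DruryArveson.multiplierAlgebra V ≃ₐ[ℂ] DruryArveson.multiplierAlgebra W)
    (hφ : ∀ f : DruryArveson.multiplierAlgebra V,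
      (φ f : W → ℂ) = (f : V → ℂ) ∘ F) :
    ∃ c C : ℝ, 0 < c ∧ 0 < C ∧ ∀ l m : W,
      c * DruryArveson.pseudohyperbolicDist (l : DruryArveson.UnitBall E') m ≤
          DruryArveson.pseudohyperbolicDist (F l : DruryArveson.UnitBall E) (F m) ∧
        DruryArveson.pseudohyperbolicDist (F l : DruryArveson.UnitBall E) (F m) ≤
          C * DruryArveson.pseudohyperbolicDist (l : DruryArveson.UnitBall E') m := by
  obtain ⟨C, hC, h⟩ := DruryArveson.exists_pseudohyperbolicDist_le F fun f hf => by
    rw [← hφ ⟨f, hf⟩]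
    exact (φ ⟨f, hf⟩).2
  obtain ⟨D, hD, h'⟩ := DruryArveson.exists_pseudohyperbolicDist_le F.symm fun g hg => by
    have h1 := hφ (φ.symm ⟨g, hg⟩)
    rw [AlgEquiv.apply_symm_apply] at h1
    change g = _ at h1
    rw [h1, Function.comp_assoc, Equiv.self_comp_symm, Function.comp_id]
    exact (φ.symm ⟨g, hg⟩).2
  refine ⟨D⁻¹, C, inv_pos.mpr hD, hC, fun l m => ⟨?_, h l m⟩⟩
  have h2 := h' (F l) (F m)
  rw [Equiv.symm_apply_apply, Equiv.symm_apply_apply] at h2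
  exact (inv_mul_le_iff₀ hD).mpr h2
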